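/- Let $m\ge 2$ be an integer and let $P\in\mathbb{C}[t]$ be a polynomial with $\deg P\ge 1$. Consider the commutative associative $\mathbb{C}$-algebras $$S_m(P)=\mathbb{C}[t,u]/\langle u^m-P(t)\rangle,\qquad R_m(P)=\mathbb{C}[t,t^{-1},u]/\langle u^m-P(t)\rangle,$$ and let $\mathcal{S}_m(P)=\operatorname{Der}_{\mathbb C}(S_m(P))$ and $\mathcal{R}_m(P)=\operatorname{Der}_{\mathbb C}(R_m(P))$ be the Lie algebras over $\mathbb{C}$ of their $\mathbb{C}$-linear derivations, with the commutator bracket. Then: (a) The Lie algebra $\mathcal{S}_m(P)$ is simple if and only if $P$ has no multiple roots in $\mathbb{C}$. (b) The Lie algebra $\mathcal{R}_m(P)$ is simple if and only if $P$ has no multiple nonzero roots in $\mathbb{C}$ and $P\neq c\,t^r$ for all $c\in\mathbb{C}\setminus\{0\}$ and all integers $r\ge 0$ with $\gcd(r,m)\neq 1$. -/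

import Mathlib

open Polynomial
open scoped LaurentPolynomial

noncomputable section

/-- The algebra `ℂ[t, u] / (u ^ m - P(t))`; the inner variable of `ℂ[X][X]` is `t`,
the outer one is `u`, and `AdjoinRoot f` is the quotient by the ideal generated by `f`. -/
abbrev SAlg (m : ℕ) (P : ℂ[X]) : Type :=
  AdjoinRoot (X ^ m - C P : ℂ[X][X])

/-- The algebra `ℂ[t, t⁻¹, u] / (u ^ m - P(t))`; the variable of the polynomial ring over
the Laurent polynomials in `t` is `u`. -/
abbrev RAlg (m : ℕ) (P : ℂ[X]) : Type :=
  AdjoinRoot (X ^ m - C (Polynomial.toLaurent P) : ℂ[T;T⁻¹][X])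

/-- The Lie algebra of `ℂ`-linear derivations of `ℂ[t, u] / (u ^ m - P(t))`,
with the commutator bracket. -/
abbrev SLie (m : ℕ) (P : ℂ[X]) : Type :=
  Derivation ℂ (SAlg m P) (SAlg m P)

/-- The Lie algebra of `ℂ`-linear derivations of `ℂ[t, t⁻¹, u] / (u ^ m - P(t))`,
with the commutator bracket. -/
abbrev RLie (m : ℕ) (P : ℂ[X]) : Type :=
  Derivation ℂ (RAlg m P) (RAlg m P)

end

/-! ### Lie ideals when the derivations form a free module of rank one. -/

section DerivationLie

variable {A : Type*} [CommRing A] [Algebra ℂ A]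

/-! Let `E` be the Hamiltonian derivation of the curve u^m = P(t), with E t = m u^(m-1) and E u =
P'(t). If u^(m-1) and P'(t) generate the unit ideal of the coordinate ring A, every derivation is a
multiple of `E`. If moreover nonzero ideals have finite codimension, A has no proper nonzero
`E`-stable ideal: multiplication by c * E b is the commutator of cE with b, hence has trace 0 on a
finite-dimensional quotient, while 1 is a sum of such elements. `Derivation.isSimple_of_free`
carries this over to Lie ideals. Finite codimension holds when A is a domain, which Eisenstein's
criterion at a simple root provides; for c t^r with gcd(r, m) = 1, A is instead a quotient of a
Laurent polynomial ring.

Conversely, at a multiple root all derivations take values in the maximal ideal M of the point, and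
those with values in M^2 form a proper nonzero Lie ideal. For c t^r on the punctured line with g =
gcd(r, m) > 1, A contains a nonconstant g-th root w of c; every derivation kills it, and (w - const)
Der A is a proper nonzero Lie ideal. -/

theorem Derivation.smul_bracket_smul (E : Derivation ℂ A A) (a b : A) :
    ⁅a • E, b • E⁆ = (a * E b - b * E a) • E := by
  ext x
  simp only [Derivation.commutator_apply, Derivation.smul_apply, smul_eq_mul, Derivation.leibniz]
  ring

/-- If `E t` and `E u` generate the unit ideal of a finite-dimensional algebra,
then the algebra is zero: multiplication by `c * E b` is a commutator, so has trace zero. -/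
theorem Derivation.subsingleton_of_unimodular {B : Type*} [CommRing B] [Algebra ℂ B]
    [Module.Finite ℂ B] (E : Derivation ℂ B B) {t u α β : B} (h : α * E t + β * E u = 1) :
    Subsingleton B := by
  have key : ∀ c b : B, LinearMap.trace ℂ B (LinearMap.mulLeft ℂ (c * E b)) = 0 := by
    intro c b
    have : LinearMap.mulLeft ℂ (c * E b) =
        (LinearMap.mulLeft ℂ c * (E : B →ₗ[ℂ] B)) * LinearMap.mulLeft ℂ b -
          LinearMap.mulLeft ℂ b * (LinearMap.mulLeft ℂ c * (E : B →ₗ[ℂ] B)) := by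
      ext x
      simp only [LinearMap.mulLeft_apply, LinearMap.sub_apply, Module.End.mul_apply,
        Derivation.coeFn_coe, Derivation.leibniz, smul_eq_mul]
      ring
    rw [this, map_sub, LinearMap.trace_mul_comm, sub_self]
  have h1 : LinearMap.trace ℂ B (LinearMap.mulLeft ℂ (1 : B)) = 0 := by
    rw [← h, show LinearMap.mulLeft ℂ (α * E t + β * E u) =
      LinearMap.mulLeft ℂ (α * E t) + LinearMap.mulLeft ℂ (β * E u) by
        ext x; simp [add_mul, mul_assoc], map_add, key, key, add_zero]
  rw [LinearMap.mulLeft_one, ← Module.End.one_eq_id, LinearMap.trace_one, Nat.cast_eq_zero] at h1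
  exact Module.finrank_zero_iff.1 h1

/-- `E` descends to A/I, where unimodularity persists and the trace argument forces A/I = 0. -/
theorem Derivation.eq_bot_or_eq_top_of_stable (E : Derivation ℂ A A) {t u α β : A}
    (h : α * E t + β * E u = 1)
    (hfin : ∀ I : Ideal A, I ≠ ⊥ → Module.Finite ℂ (A ⧸ I))
    (I : Ideal A) (hI : ∀ x ∈ I, E x ∈ I) : I = ⊥ ∨ I = ⊤ := by
  by_cases hb : I = ⊥
  · exact Or.inl hb
  right
  have := hfin I hb
  have hd : ∀ x, Ideal.Quotient.mkₐ ℂ I x = 0 → Ideal.Quotient.mkₐ ℂ I (E x) = 0 := by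
    intro x hx
    rw [Ideal.Quotient.mkₐ_eq_mk, Ideal.Quotient.eq_zero_iff_mem] at hx ⊢
    exact hI x hx
  have hs : Function.Surjective (Ideal.Quotient.mkₐ ℂ I) := Ideal.Quotient.mkₐ_surjective ℂ I
  have h2 : Ideal.Quotient.mkₐ ℂ I α *
        Derivation.liftOfSurjective hs hd (Ideal.Quotient.mkₐ ℂ I t) +
      Ideal.Quotient.mkₐ ℂ I β *
        Derivation.liftOfSurjective hs hd (Ideal.Quotient.mkₐ ℂ I u) = 1 := by
    rw [Derivation.liftOfSurjective_apply, Derivation.liftOfSurjective_apply,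
      ← map_mul, ← map_mul, ← map_add, h, map_one]
  have := Derivation.subsingleton_of_unimodular _ h2
  exact Ideal.Quotient.subsingleton_iff.1 this

/-- The Lie algebra of derivations is simple when it is free of rank one on a derivation `E` with
`E t`, `E u` unimodular, and the algebra has no nontrivial `E`-stable ideals. -/
theorem Derivation.isSimple_of_free [Nontrivial A] (E : Derivation ℂ A A) {t u α β : A}
    (h : α * E t + β * E u = 1) (hE : ∀ D : Derivation ℂ A A, ∃ a : A, D = a • E)
    (hs : ∀ I : Ideal A, (∀ x ∈ I, E x ∈ I) → I = ⊥ ∨ I = ⊤) :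
    LieAlgebra.IsSimple ℂ (Derivation ℂ A A) := by
  have hinj : ∀ a : A, a • E = 0 → a = 0 := by
    intro a ha
    have h1 : a * E t = 0 := by simpa using Derivation.congr_fun ha t
    have h2 : a * E u = 0 := by simpa using Derivation.congr_fun ha u
    linear_combination α * h1 + β * h2 - a * h
  refine ⟨fun J => ?_, fun hab => ?_⟩
  · have hW : ∀ a x : A, x • E ∈ J → (a * E x - x * E a) • E ∈ J := fun a x hx => by
      rw [← Derivation.smul_bracket_smul]; exact lie_mem_right ℂ _ J _ _ hx
    have hDx : ∀ x : A, x • E ∈ J → (E x) • E ∈ J := fun x hx => by simpa using hW 1 x hx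
    -- The conductor of J: the largest ideal whose multiples of `E` all lie in J.
    let C : Ideal A :=
      { carrier := {p | ∀ a : A, (a * p) • E ∈ J}
        add_mem' := fun {p q} hp hq a => by
          rw [mul_add, add_smul]; exact add_mem (hp a) (hq a)
        zero_mem' := fun a => by simp
        smul_mem' := fun c p hp a => by
          rw [smul_eq_mul, ← mul_assoc]; exact hp _ }
    have hC : ∀ p ∈ C, E p ∈ C := by
      intro p hp a
      have h1 := hDx _ (hp a)
      have h2 := hp (E a)
      rw [show a * E p = E (a * p) - E a * p by simp [mul_comm], sub_smul]
      exact sub_mem h1 h2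
    have h2mem : ∀ v : A, (2 * v) • E ∈ J → v • E ∈ J := by
      intro v hv
      have := J.smul_mem (2⁻¹ : ℂ) hv
      rwa [mul_smul, ← smul_assoc, show (2⁻¹ : ℂ) • (2 : A) = 1 by
        rw [Algebra.smul_def, ← map_ofNat (algebraMap ℂ A) 2, ← map_mul]; norm_num, one_smul] at this
    rcases hs C hC with hbot | htop
    · left
      have hW0 : ∀ x y : A, x • E ∈ J → y • E ∈ J → x * E y - y * E x = 0 := by
        intro x y hx hy
        -- [(xa)E, yE] - [(ya)E, xE] = 2a(x E y - y E x)E.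
        have : x * E y - y * E x ∈ C := by
          intro a
          apply h2mem
          have h1 := hW (y * a) x hx
          have h2 := hW (x * a) y hy
          have := sub_mem h2 h1
          rw [← sub_smul] at this
          convert this using 2
          simp only [Derivation.leibniz, smul_eq_mul]
          ring
        rw [hbot] at this
        exact this
      have two_cancel : ∀ v : A, 2 * v = 0 → v = 0 := fun v hv => by
        have : (2 : ℂ) • v = 0 := by rw [Algebra.smul_def, map_ofNat, hv]
        exact (smul_eq_zero_iff_right two_ne_zero).1 this
      have hsq : ∀ x : A, x • E ∈ J → x * x = 0 := by
        intro x hx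
        -- The Wronskians of x with a E x - x E a and with E x both vanish.
        have hf : ∀ a : A, x * x * E (E a) - x * E x * E a = 0 := by
          intro a
          have := hW0 x _ hx (hW a x hx)
          simp only [map_sub, Derivation.leibniz, smul_eq_mul] at this
          have h3 := hW0 x _ hx (hDx x hx)
          linear_combination (-1 : A) * this + a * h3
        -- Polarization: applying the second-order operator of `hf` to a product ab leaves the
        -- symbol 2x² E a E b.
        have hp : ∀ a b : A, x * x * (E a * E b) = 0 := by
          intro a b
          apply two_cancel
          have h1 := hf (a * b)
          simp only [map_add, Derivation.leibniz, smul_eq_mul] at h1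
          linear_combination h1 - a * hf b - b * hf a
        have h1 : x * x = x * x * ((α * E t + β * E u) * (α * E t + β * E u)) := by rw [h]; ring
        rw [h1]
        linear_combination α * α * hp t t + 2 * α * β * hp t u + β * β * hp u u
      have hmul : ∀ x y : A, x • E ∈ J → y • E ∈ J → x * y = 0 := by
        intro x y hx hy
        apply two_cancel
        have := hsq (x + y) (by rw [add_smul]; exact add_mem hx hy)
        linear_combination this - hsq x hx - hsq y hy
      have hst : ∀ p ∈ Ideal.span {x : A | x • E ∈ J}, E p ∈ Ideal.span {x : A | x • E ∈ J} := by
        intro p hp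
        induction hp using Submodule.span_induction with
        | mem x hx => exact Ideal.subset_span (hDx x hx)
        | zero => simp
        | add x y _ _ hx hy => rw [map_add]; exact add_mem hx hy
        | smul a x hx' hx =>
          rw [smul_eq_mul, Derivation.leibniz]
          exact add_mem (Ideal.mul_mem_left _ _ hx) (by
            rw [smul_eq_mul, mul_comm]; exact Ideal.mul_mem_left _ _ hx')
      have hzero : ∀ x : A, x • E ∈ J → x = 0 := by
        rcases hs _ hst with h0 | h1
        · intro x hx
          have : x ∈ Ideal.span {x : A | x • E ∈ J} := Ideal.subset_span hx
          rwa [h0] at this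
        · intro x hx
          have : ∀ p ∈ Ideal.span {x : A | x • E ∈ J}, x * p = 0 := by
            intro p hp
            induction hp using Submodule.span_induction with
            | mem y hy => exact hmul x y hx hy
            | zero => simp
            | add y z _ _ hy hz => rw [mul_add, hy, hz, add_zero]
            | smul a y _ hy => rw [smul_eq_mul, mul_left_comm, hy, mul_zero]
          simpa using this 1 (by rw [h1]; trivial)
      rw [eq_bot_iff]
      intro D hD
      obtain ⟨a, rfl⟩ := hE D
      rw [hzero a hD, zero_smul]
      exact zero_mem _
    · right
      rw [eq_top_iff]
      intro D _
      obtain ⟨a, rfl⟩ := hE D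
      have h1 : (1 : A) ∈ C := by rw [htop]; trivial
      simpa using h1 a
  -- [E, aE] = (E a)E, so an abelian algebra would force E = 0, against unimodularity.
  · have hab' : ∀ a : A, E a = 0 := by
      intro a
      have h1 : ⁅(1 : A) • E, a • E⁆ = 0 := hab.trivial _ _
      rw [Derivation.smul_bracket_smul] at h1
      simpa using hinj _ h1
    rw [hab', hab'] at h
    simp at h

end DerivationLie

/-! ### The curve u^m = P(t), treated through its universal property. -/

/-- `A` is generated by `t`, `u` (and the inverse of `t`, when `inv` holds) subject only to
the relation `u ^ m = P(t)`. -/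
structure IsCurve (inv : Prop) (m : ℕ) (P : ℂ[X]) {A : Type} [CommRing A] [Algebra ℂ A]
    (t u : A) : Prop where
  rel : u ^ m = aeval t P
  isUnit : inv → IsUnit t
  eq_top : ∀ S : Subalgebra ℂ A, t ∈ S → u ∈ S → (∀ y, y * t = 1 → y ∈ S) → S = ⊤
  finiteType : Algebra.FiniteType ℂ A
  exists_hom : ∀ {B : Type} [CommRing B] [Algebra ℂ B] (τ υ : B), (inv → IsUnit τ) →
    υ ^ m = aeval τ P → ∃ φ : A →ₐ[ℂ] B, φ t = τ ∧ φ u = υ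

namespace IsCurve

variable {inv : Prop} {m : ℕ} {P : ℂ[X]} {A : Type} [CommRing A] [Algebra ℂ A] {t u : A}

theorem algHom_ext (h : IsCurve inv m P t u) {B : Type*} [CommRing B] [Algebra ℂ B]
    {f g : A →ₐ[ℂ] B} (ht : f t = g t) (hu : f u = g u) : f = g := by
  have : AlgHom.equalizer f g = ⊤ := by
    refine h.eq_top _ ht hu fun y hy => ?_
    have h1 : f y * f t = 1 := by rw [← map_mul, hy, map_one]
    have h2 : g y * g t = 1 := by rw [← map_mul, hy, map_one]
    change f y = g y
    rw [← ht] at h2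
    linear_combination g y * h1 - f y * h2
  ext a
  have ha : a ∈ AlgHom.equalizer f g := by rw [this]; trivial
  exact ha

theorem derivation_mem (h : IsCurve inv m P t u) (D : Derivation ℂ A A) (I : Ideal A)
    (ht : D t ∈ I) (hu : D u ∈ I) (a : A) : D a ∈ I := by
  let S : Subalgebra ℂ A :=
    { carrier := {a | D a ∈ I}
      mul_mem' := fun {a b} ha hb => by
        simp only [Set.mem_ofPred_eq, Derivation.leibniz, smul_eq_mul] at *
        exact add_mem (I.mul_mem_left _ hb) (I.mul_mem_left _ ha)
      add_mem' := fun {a b} ha hb => by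
        simp only [Set.mem_ofPred_eq, map_add] at *
        exact add_mem ha hb
      algebraMap_mem' := fun r => by simp }
  have hS : S = ⊤ := by
    refine h.eq_top S ht hu fun y hy => ?_
    change D y ∈ I
    rw [D.leibniz_of_mul_eq_one hy]
    exact I.mul_mem_left _ ht
  have : a ∈ S := by rw [hS]; trivial
  exact this

theorem derivation_ext (h : IsCurve inv m P t u) {D₁ D₂ : Derivation ℂ A A}
    (ht : D₁ t = D₂ t) (hu : D₁ u = D₂ u) : D₁ = D₂ := by
  ext a
  have := h.derivation_mem (D₁ - D₂) ⊥ (by simp [ht]) (by simp [hu]) a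
  simpa [sub_eq_zero] using this

theorem derivation_rel (h : IsCurve inv m P t u) (D : Derivation ℂ A A) :
    m * u ^ (m - 1) * D u = aeval t (derivative P) * D t := by
  have := congrArg D h.rel
  rw [Derivation.leibniz_pow, Derivation.map_aeval] at this
  simpa [mul_assoc] using this

/-- A derivation is the ε-part of an algebra section of A[ε] → A; the hypothesis is the ε-part of
the relation at (t + εa, u + εb). -/
theorem exists_derivation (h : IsCurve inv m P t u) {a b : A}
    (hab : m * u ^ (m - 1) * b = aeval t (derivative P) * a) :
    ∃ D : Derivation ℂ A A, D t = a ∧ D u = b := by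
  have haeval : ∀ (Q : ℂ[X]) (x y : A),
      aeval (TrivSqZeroExt.inl x + TrivSqZeroExt.inr y : DualNumber A) Q =
        TrivSqZeroExt.inl (aeval x Q) + TrivSqZeroExt.inr (aeval x (derivative Q) * y) := by
    intro Q x y
    have hinl : ∀ R : ℂ[X], aeval (TrivSqZeroExt.inl x : DualNumber A) R =
        TrivSqZeroExt.inl (aeval x R) := fun R =>
      aeval_algHom_apply (TrivSqZeroExt.inlAlgHom ℂ A A) x R
    rw [aeval_add_of_sq_eq_zero _ _ _ (by rw [pow_two, TrivSqZeroExt.inr_mul_inr]), hinl, hinl,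
      TrivSqZeroExt.inl_mul_inr, smul_eq_mul]
  obtain ⟨φ, h1, h2⟩ := h.exists_hom (B := DualNumber A)
    (TrivSqZeroExt.inl t + TrivSqZeroExt.inr a) (TrivSqZeroExt.inl u + TrivSqZeroExt.inr b)
    (fun hi => by
      rw [TrivSqZeroExt.isUnit_iff_isUnit_fst]
      simpa using h.isUnit hi)
    (by
      have := haeval (X ^ m) u b
      rw [map_pow, aeval_X] at this
      rw [this, haeval, map_pow, aeval_X, h.rel, derivative_X_pow]
      simp [hab])
  have hid : (TrivSqZeroExt.fstHom ℂ A A).comp φ = AlgHom.id ℂ A :=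
    h.algHom_ext (by simp [h1]) (by simp [h2])
  have hfst : ∀ x, (φ x).fst = x := fun x => DFunLike.congr_fun hid x
  refine ⟨Derivation.mk' ((TrivSqZeroExt.sndHom A A).restrictScalars ℂ ∘ₗ φ.toLinearMap) ?_, ?_, ?_⟩
  · intro x y
    simp [TrivSqZeroExt.snd_mul, hfst, mul_comm]
  · simp [h1]
  · simp [h2]

theorem exists_point (h : IsCurve inv m P t u) (hm : m ≠ 0) {w : ℂ} (hw : inv → w ≠ 0) :
    ∃ φ : A →ₐ[ℂ] ℂ, φ t = w := by
  obtain ⟨η, hη⟩ := IsAlgClosed.exists_pow_nat_eq (P.eval w) (Nat.pos_of_ne_zero hm)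
  obtain ⟨φ, hφ, -⟩ := h.exists_hom w η (fun hi => (hw hi).isUnit) (by simpa using hη)
  exact ⟨φ, hφ⟩

theorem nontrivial (h : IsCurve inv m P t u) (hm : m ≠ 0) : Nontrivial A := by
  obtain ⟨φ, -⟩ := h.exists_point hm (w := 1) (fun _ => one_ne_zero)
  exact φ.toRingHom.domain_nontrivial

theorem aeval_ne_zero (h : IsCurve inv m P t u) (hm : m ≠ 0) {Q : ℂ[X]} (hQ : Q ≠ 0) :
    aeval t Q ≠ 0 := by
  -- The factor `X` keeps w away from 0, so that w is an admissible value of t even when t is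
  -- invertible.
  obtain ⟨w, hw⟩ := Infinite.exists_notMem_finset (Q * X).roots.toFinset
  rw [Multiset.mem_toFinset, mem_roots (mul_ne_zero hQ X_ne_zero), IsRoot, eval_mul, eval_X,
    mul_eq_zero, not_or] at hw
  obtain ⟨φ, hφ⟩ := h.exists_point hm (w := w) (fun _ => hw.2)
  intro h0
  apply hw.1
  have := congrArg φ h0
  rwa [← aeval_algHom_apply, hφ, map_zero, coe_aeval_eq_eval] at this

theorem finite_quotient (h : IsCurve inv m P t u) (hm : m ≠ 0) (I : Ideal A)
    (hI : IsIntegral ℂ (Ideal.Quotient.mkₐ ℂ I t)) : Module.Finite ℂ (A ⧸ I) := by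
  have hft := h.finiteType
  have hS : (integralClosure ℂ (A ⧸ I)).comap (Ideal.Quotient.mkₐ ℂ I) = ⊤ := by
    refine h.eq_top _ hI ?_ ?_
    · refine IsIntegral.of_pow (Nat.pos_of_ne_zero hm) ?_
      rw [RingHom.coe_coe, ← map_pow, h.rel, ← aeval_algHom_apply]
      exact IsIntegral.of_mem_of_fg _ hI.fg_adjoin_singleton _ (aeval_mem_adjoin_singleton _ _)
    · intro y hy
      have h1 : Ideal.Quotient.mkₐ ℂ I t * Ideal.Quotient.mkₐ ℂ I y = 1 := by
        rw [← map_mul, mul_comm, hy, map_one]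
      let i : Invertible (Ideal.Quotient.mkₐ ℂ I t) := ⟨_, by rw [mul_comm]; exact h1, h1⟩
      exact (hI.isAlgebraic.invOf (x := Ideal.Quotient.mkₐ ℂ I t)).isIntegral
  have : Algebra.IsIntegral ℂ (A ⧸ I) := ⟨fun x => by
    obtain ⟨a, rfl⟩ := Ideal.Quotient.mkₐ_surjective ℂ I x
    have : a ∈ (integralClosure ℂ (A ⧸ I)).comap (Ideal.Quotient.mkₐ ℂ I) := by rw [hS]; trivial
    exact this⟩
  exact Algebra.IsIntegral.finite

theorem isSimple (h : IsCurve inv m P t u) (hm : m ≠ 0) {α β : A}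
    (hco : α * u ^ (m - 1) + β * aeval t (derivative P) = 1)
    (hfin : ∀ I : Ideal A, I ≠ ⊥ → IsIntegral ℂ (Ideal.Quotient.mkₐ ℂ I t)) :
    LieAlgebra.IsSimple ℂ (Derivation ℂ A A) := by
  have := h.nontrivial hm
  have hmA : algebraMap ℂ A (m : ℂ)⁻¹ * m = 1 := by
    rw [← map_natCast (algebraMap ℂ A) m, ← map_mul,
      inv_mul_cancel₀ (Nat.cast_ne_zero.2 hm), map_one]
  obtain ⟨E, hEt, hEu⟩ := h.exists_derivation
    (a := m * u ^ (m - 1)) (b := aeval t (derivative P)) (mul_comm _ _)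
  have h1 : (α * algebraMap ℂ A (m : ℂ)⁻¹) * E t + β * E u = 1 := by
    rw [hEt, hEu]
    linear_combination hco + α * u ^ (m - 1) * hmA
  refine Derivation.isSimple_of_free E h1 (fun D => ?_)
    (E.eq_bot_or_eq_top_of_stable h1 fun I hI => h.finite_quotient hm I (hfin I hI))
  have hD := h.derivation_rel D
  rw [hEt, hEu] at h1
  -- D must be the combination of D t and D u with the cofactors of E t and E u; `derivation_rel`
  -- makes both coordinates agree.
  refine ⟨(α * algebraMap ℂ A (m : ℂ)⁻¹) * D t + β * D u, h.derivation_ext ?_ ?_⟩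
  · rw [Derivation.smul_apply, smul_eq_mul, hEt]
    linear_combination (-D t) * h1 - β * hD
  · rw [Derivation.smul_apply, smul_eq_mul, hEu]
    linear_combination (-D u) * h1 + (α * algebraMap ℂ A (m : ℂ)⁻¹) * hD

end IsCurve

/-! ### Obstructions to simplicity: multiple roots and monomials. -/

/-- At a multiple root `z`, the derivative of `P` vanishes to order exactly one less than `P`. -/
theorem Polynomial.exists_eq_pow_mul_of_two_le_rootMultiplicity {P : ℂ[X]} (hP : P ≠ 0) {z : ℂ}
    (hroot : 2 ≤ P.rootMultiplicity z) : ∃ (k : ℕ) (Q R : ℂ[X]),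
      P = (X - C z) ^ (k + 2) * Q ∧ derivative P = (X - C z) ^ (k + 1) * R ∧
      Q ≠ 0 ∧ R.eval z ≠ 0 := by
  obtain ⟨Q, hQ, hndvd⟩ := P.exists_eq_pow_rootMultiplicity_mul_and_not_dvd hP z
  obtain ⟨k, hk⟩ := Nat.exists_eq_add_of_le' hroot
  rw [hk] at hQ
  have hQz : Q.eval z ≠ 0 := fun h0 => hndvd (dvd_iff_isRoot.2 h0)
  refine ⟨k, Q, C ((k : ℂ) + 2) * Q + (X - C z) * derivative Q, hQ, ?_, ?_, ?_⟩
  · conv_lhs => rw [hQ]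
    simp only [derivative_mul, derivative_X_sub_C_pow, map_add, map_natCast, map_ofNat]
    rw [show k + 2 - 1 = k + 1 by omega]
    push_cast
    ring
  · rintro rfl
    exact hQz eval_zero
  · have : (k : ℂ) + 2 ≠ 0 := by exact_mod_cast (by omega : k + 2 ≠ 0)
    simp [hQz, this]

theorem LieAlgebra.IsSimple.eq_zero_or_mem {L : Type*} [LieRing L] [LieAlgebra ℂ L]
    (hL : LieAlgebra.IsSimple ℂ L) (N : Submodule ℂ L) (hN : ∀ x y : L, y ∈ N → ⁅x, y⁆ ∈ N) :
    (∀ x ∈ N, x = 0) ∨ ∀ x, x ∈ N := by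
  let J : LieIdeal ℂ L := { N with lie_mem := fun {x y} hy => hN x y hy }
  rcases hL.eq_bot_or_eq_top J with h | h
  · left
    intro x hx
    have : x ∈ J := hx
    rwa [h, LieSubmodule.mem_bot] at this
  · right
    intro x
    have : x ∈ J := by rw [h]; trivial
    exact this

namespace IsCurve

variable {inv : Prop} {m : ℕ} {P : ℂ[X]} {A : Type} [CommRing A] [Algebra ℂ A] {t u : A}

/-- If every derivation preserves the maximal ideal of a multiple root of `P`, then the Lie algebra
of derivations is not simple: the derivations with values in the square of this
ideal form a proper nonzero ideal. -/
theorem not_isSimple_of_multiple_root (h : IsCurve inv m P t u) (hm : 2 ≤ m) (hP : P ≠ 0)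
    {z : ℂ} (hz : inv → z ≠ 0) (hroot : 2 ≤ P.rootMultiplicity z)
    (hstable : ∀ a b : A, m * u ^ (m - 1) * b = aeval t (derivative P) * a →
      ∀ χ : A →ₐ[ℂ] ℂ, χ t = z → χ u = 0 → χ a = 0 ∧ χ b = 0) :
    ¬ LieAlgebra.IsSimple ℂ (Derivation ℂ A A) := by
  intro hsimple
  have hm0 : m ≠ 0 := by omega
  obtain ⟨k, Q, R, hQ, hP', hQ0, hRz⟩ :=
    exists_eq_pow_mul_of_two_le_rootMultiplicity hP hroot
  have hPz : P.eval z = 0 := by rw [hQ]; simp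
  -- A tangent vector at (z, 0) in the u-direction, which exists because ε^m = 0. It kills M², so it
  -- detects elements outside M².
  obtain ⟨φ, hφt, hφu⟩ := h.exists_hom (B := DualNumber ℂ) (algebraMap ℂ _ z) DualNumber.eps
    (fun hi => (hz hi).isUnit.map _)
    (by
      obtain ⟨n, rfl⟩ := Nat.exists_eq_add_of_le hm
      rw [aeval_algebraMap_apply, coe_aeval_eq_eval, hPz, map_zero, pow_add, pow_two,
        DualNumber.eps_mul_eps, zero_mul])
  let χ : A →ₐ[ℂ] ℂ := (TrivSqZeroExt.fstHom ℂ ℂ ℂ).comp φ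
  have hχ : ∀ a, χ a = (φ a).fst := fun a => rfl
  have hχt : χ t = z := by rw [hχ, hφt]; rfl
  have hχu : χ u = 0 := by rw [hχ, hφu]; rfl
  set M : Ideal A := RingHom.ker χ with hM
  have hDM : ∀ (D : Derivation ℂ A A) (a : A), D a ∈ M := by
    intro D a
    obtain ⟨h1, h2⟩ := hstable _ _ (h.derivation_rel D) χ hχt hχu
    exact h.derivation_mem D M h1 h2 a
  have hDM2 : ∀ (D : Derivation ℂ A A), ∀ a ∈ M * M, D a ∈ M * M := by
    intro D a ha
    induction ha using Submodule.mul_induction_on' with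
    | mem_mul_mem x hx y hy =>
      rw [Derivation.leibniz]
      exact add_mem (Ideal.mul_mem_mul hx (hDM D y)) (Ideal.mul_mem_mul hy (hDM D x))
    | add x _ y _ hx hy => rw [map_add]; exact add_mem hx hy
  have hφM : ∀ a ∈ M * M, φ a = 0 := by
    intro a ha
    induction ha using Submodule.mul_induction_on' with
    | mem_mul_mem x hx y hy =>
      have hx' : (φ x).fst = 0 := hx
      have hy' : (φ y).fst = 0 := hy
      rw [map_mul]
      ext <;> simp [hx', hy']
    | add x _ y _ hx hy => rw [map_add, hx, hy, add_zero]
  let N : Submodule ℂ (Derivation ℂ A A) :=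
    { carrier := {D | ∀ a, D a ∈ M * M}
      add_mem' := fun {D E} hD hE a => add_mem (hD a) (hE a)
      zero_mem' := fun a => zero_mem _
      smul_mem' := fun c D hD a => by
        rw [Derivation.smul_apply, Algebra.smul_def]
        exact Ideal.mul_mem_left _ _ (hD a) }
  have hPR : C (m : ℂ) * P * R =
      (X - C z) ^ (k + 1) * R * (C (m : ℂ) * ((X - C z) * Q)) := by
    rw [hQ]
    ring
  -- E multiplied by u and divided by the common factor (t - z)^(k+1). Then (t - z)²D is a nonzero
  -- element of `N`, while `φ` sends D u to R(z)ε ≠ 0, so D is not in `N`.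
  obtain ⟨D, hDt, hDu⟩ := h.exists_derivation (a := aeval t (C (m : ℂ) * ((X - C z) * Q)))
    (b := u * aeval t R) (by
      have h1 : u ^ (m - 1) * u = aeval t P := by rw [← h.rel, pow_sub_one_mul hm0]
      have h2 : (m : A) = aeval t (C (m : ℂ)) := by simp
      rw [← map_mul, hP', show m * u ^ (m - 1) * (u * aeval t R) =
        m * (u ^ (m - 1) * u) * aeval t R by ring, h1, h2, ← map_mul, ← map_mul, hPR])
  rcases hsimple.eq_zero_or_mem N (fun D E hE a => by
    rw [Derivation.commutator_apply]
    exact sub_mem (hDM2 _ _ (hE a)) (hE _)) with h0 | h1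
  · have hmem : (aeval t ((X - C z) * (X - C z)) : A) • D ∈ N := by
      intro a
      rw [Derivation.smul_apply, smul_eq_mul, map_mul]
      have : aeval t (X - C z) ∈ M := by
        rw [hM, RingHom.mem_ker, ← aeval_algHom_apply, hχt]; simp
      exact Ideal.mul_mem_right _ _ (Ideal.mul_mem_mul this this)
    have := Derivation.congr_fun (h0 _ hmem) t
    rw [Derivation.smul_apply, smul_eq_mul, hDt, ← map_mul] at this
    refine h.aeval_ne_zero hm0 ?_ this
    have := X_sub_C_ne_zero z
    have : (C (m : ℂ)) ≠ 0 := C_ne_zero.2 (Nat.cast_ne_zero.2 hm0)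
    simp_all
  · have := hφM _ (h1 D u)
    rw [hDu, map_mul, hφu, ← aeval_algHom_apply, hφt, aeval_algebraMap_apply,
      coe_aeval_eq_eval] at this
    have h2 := congrArg TrivSqZeroExt.snd this
    rw [DualNumber.snd_mul] at h2
    exact hRz (by simpa [TrivSqZeroExt.algebraMap_eq_inl] using h2)

/-- If `P = c * t ^ r` with `t` invertible and `gcd r m ≠ 1`, there is a nonconstant element killed
by all derivations, hence the Lie algebra of derivations is not simple. -/
theorem not_isSimple_of_monomial {c : ℂ} {r : ℕ} (h : IsCurve True m (C c * X ^ r) t u)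
    (hm : 2 ≤ m) (hc : c ≠ 0) (hr : Nat.gcd r m ≠ 1) :
    ¬ LieAlgebra.IsSimple ℂ (Derivation ℂ A A) := by
  intro hsimple
  have hm0 : m ≠ 0 := by omega
  obtain ⟨y, hy⟩ := (h.isUnit trivial).exists_left_inv
  set g := Nat.gcd r m with hg
  have hg0 : g ≠ 0 := fun h0 => hm0 (Nat.eq_zero_of_gcd_eq_zero_right h0)
  obtain ⟨r', hr'⟩ : g ∣ r := Nat.gcd_dvd_left r m
  obtain ⟨m', hm'⟩ : g ∣ m := Nat.gcd_dvd_right r m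
  have hm'0 : m' ≠ 0 := by rintro rfl; simp at hm'; omega
  have hlt : m' < m := by
    rw [hm']
    exact (Nat.lt_mul_iff_one_lt_left (Nat.pos_of_ne_zero hm'0)).2 (by omega)
  have hrel : u ^ m = algebraMap ℂ A c * t ^ r := by simpa using h.rel
  set w : A := u ^ m' * y ^ r' with hw
  have hwg : w ^ g = algebraMap ℂ A c := by
    rw [hw, mul_pow, ← pow_mul, ← pow_mul, mul_comm m', mul_comm r', ← hm', ← hr', hrel, mul_assoc,
      ← mul_pow, mul_comm t, hy, one_pow, mul_one]
  have hwu : IsUnit w := by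
    rw [← isUnit_pow_iff hg0, hwg]
    exact hc.isUnit.map _
  have hgu : IsUnit (g : A) := by
    rw [← map_natCast (algebraMap ℂ A)]
    exact (Nat.cast_ne_zero.2 hg0 : (g : ℂ) ≠ 0).isUnit.map _
  have hDw : ∀ D : Derivation ℂ A A, D w = 0 := by
    intro D
    have h1 := congrArg D hwg
    rw [Derivation.leibniz_pow, Derivation.map_algebraMap, nsmul_eq_mul, smul_eq_mul] at h1
    exact (hwu.pow _).mul_right_eq_zero.1 (hgu.mul_right_eq_zero.1 h1)
  obtain ⟨η, hη⟩ := IsAlgClosed.exists_pow_nat_eq c (Nat.pos_of_ne_zero hm0)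
  have hη0 : η ≠ 0 := by rintro rfl; rw [zero_pow hm0] at hη; exact hc hη.symm
  have hpt : ∀ ξ : ℂ, ξ ^ m = c → ∃ φ : A →ₐ[ℂ] ℂ, φ t = 1 ∧ φ w = ξ ^ m' := by
    intro ξ hξ
    obtain ⟨φ, h1, h2⟩ := h.exists_hom (1 : ℂ) ξ (fun _ => isUnit_one) (by simpa using hξ)
    have h3 := congrArg φ hy
    rw [map_mul, h1, mul_one, map_one] at h3
    exact ⟨φ, h1, by rw [hw, map_mul, map_pow, map_pow, h2, h3, one_pow, mul_one]⟩
  -- v vanishes at the point (1, η) but not at (1, ζη), ζ a primitive m-th root of unity, since 0 <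
  -- m' < m. The first point shows that `N` is proper, the second that it is nonzero.
  set v : A := w - algebraMap ℂ A (η ^ m') with hv
  let N : Submodule ℂ (Derivation ℂ A A) :=
    { carrier := {D | ∃ E : Derivation ℂ A A, D = v • E}
      add_mem' := by
        rintro _ _ ⟨D, rfl⟩ ⟨E, rfl⟩
        exact ⟨D + E, (smul_add _ _ _).symm⟩
      zero_mem' := ⟨0, (smul_zero _).symm⟩
      smul_mem' := by
        rintro a _ ⟨D, rfl⟩
        exact ⟨a • D, smul_comm _ _ _⟩ }
  -- The Euler derivation for the grading with t of weight m and u of weight r.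
  obtain ⟨D, hDt, -⟩ := h.exists_derivation (a := m * t) (b := r * u) (by
    have h1 : u ^ (m - 1) * u = u ^ m := pow_sub_one_mul hm0 u
    rw [show m * u ^ (m - 1) * (r * u) = m * r * (u ^ (m - 1) * u) by ring, h1, hrel]
    rcases Nat.eq_zero_or_pos r with h0 | h0
    · simp [h0]
    · have h2 : t ^ (r - 1) * t = t ^ r := pow_sub_one_mul h0.ne' t
      rw [← h2, derivative_C_mul_X_pow]
      simp
      ring)
  rcases hsimple.eq_zero_or_mem N (by
    rintro D _ ⟨E, rfl⟩
    refine ⟨⁅D, E⁆, ?_⟩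
    ext a
    have : D v = 0 := by rw [hv, map_sub, hDw, Derivation.map_algebraMap, sub_zero]
    simp only [Derivation.commutator_apply, Derivation.smul_apply, smul_eq_mul, Derivation.leibniz,
      this]
    ring) with h0 | h1
  · have h2 := Derivation.congr_fun (h0 (v • D) ⟨D, rfl⟩) t
    rw [Derivation.smul_apply, hDt, smul_eq_mul, Derivation.zero_apply] at h2
    have hζ := Complex.isPrimitiveRoot_exp m hm0
    set ζ := Complex.exp (2 * Real.pi * Complex.I / m)
    obtain ⟨φ, hφt, hφw⟩ := hpt (ζ * η) (by rw [mul_pow, hζ.pow_eq_one, one_mul, hη])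
    have h3 := congrArg φ h2
    rw [map_mul, map_mul, hφt, map_natCast, map_zero, hv, map_sub, hφw, AlgHom.commutes, mul_pow,
      Algebra.algebraMap_self_apply] at h3
    have h4 : (ζ ^ m' - 1) * η ^ m' = 0 := by
      have : (m : ℂ) ≠ 0 := Nat.cast_ne_zero.2 hm0
      apply mul_right_cancel₀ this
      linear_combination h3
    have h5 : ζ ^ m' = 1 := by
      rcases mul_eq_zero.1 h4 with h5 | h5
      · exact sub_eq_zero.1 h5
      · exact absurd h5 (pow_ne_zero _ hη0)
    exact hζ.pow_ne_one_of_pos_of_lt hm'0 hlt h5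
  · obtain ⟨E, hE⟩ := h1 D
    have h2 := Derivation.congr_fun hE t
    obtain ⟨φ, hφt, hφw⟩ := hpt η hη
    have h3 := congrArg φ h2
    rw [hDt, Derivation.smul_apply, smul_eq_mul, map_mul, map_mul, hφt, hv, map_sub, hφw,
      AlgHom.commutes, map_natCast, Algebra.algebraMap_self_apply, sub_self, zero_mul, mul_one,
      Nat.cast_eq_zero] at h3
    exact hm0 h3

end IsCurve

/-! ### Laurent polynomials as a localization of ℂ[X]. -/

namespace LaurentPolynomial

instance isDomain_complex : IsDomain ℂ[T;T⁻¹] :=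
  IsLocalization.isDomain_of_le_nonZeroDivisors (R := ℂ[X]) (M := Submonoid.powers (X : ℂ[X])) _
    (powers_le_nonZeroDivisors_of_noZeroDivisors X_ne_zero)

instance isPrincipalIdealRing_complex : IsPrincipalIdealRing ℂ[T;T⁻¹] where
  principal I := by
    obtain ⟨g, hg⟩ := (IsPrincipalIdealRing.principal (I.under ℂ[X])).principal
    refine ⟨algebraMap ℂ[X] ℂ[T;T⁻¹] g, ?_⟩
    have := IsLocalization.map_under (Submonoid.powers (X : ℂ[X])) ℂ[T;T⁻¹] I
    rw [hg] at this
    rw [← this, ← Ideal.span, ← Ideal.span, Ideal.map_span, Set.image_singleton]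

theorem exists_algHom {B : Type*} [CommRing B] [Algebra ℂ B] {τ : B} (hτ : IsUnit τ) :
    ∃ φ : ℂ[T;T⁻¹] →ₐ[ℂ] B, φ (T 1) = τ := by
  obtain ⟨x, rfl⟩ := hτ
  refine ⟨{ eval₂ (algebraMap ℂ B) x with
    commutes' := fun r => ?_ }, ?_⟩
  · change eval₂ (algebraMap ℂ B) x (algebraMap ℂ ℂ[T;T⁻¹] r) = _
    rw [← C_eq_algebraMap, eval₂_C]
  · change eval₂ (algebraMap ℂ B) x (T 1) = _
    rw [eval₂_T, zpow_one]

theorem aeval_T_one (P : ℂ[X]) : aeval (T 1 : ℂ[T;T⁻¹]) P = toLaurent P := by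
  rw [← toLaurent_X, ← coe_toLaurentAlg, aeval_algHom_apply, aeval_X_left_apply]

theorem subalgebra_eq_top {S : Subalgebra ℂ ℂ[T;T⁻¹]} (h : T 1 ∈ S) (h' : T (-1) ∈ S) : S = ⊤ := by
  rw [eq_top_iff]
  intro f _
  induction f using LaurentPolynomial.induction_on' with
  | add p q hp hq => exact add_mem (hp trivial) (hq trivial)
  | C_mul_T n a =>
    refine mul_mem (S.algebraMap_mem a) ?_
    obtain ⟨k, rfl | rfl⟩ := n.eq_nat_or_neg
    · simpa [T_pow] using pow_mem h k
    · simpa [T_pow] using pow_mem h' k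

end LaurentPolynomial

/-! ### The extensions K[u]/(u^m - p): integrality of the domain and coefficient comparison. -/

section Kummer

variable {K : Type} [CommRing K] {m : ℕ} {p : K}

/-- Eisenstein at the kernel of the underlying point: ψ kills the square of this prime, so ψ p ≠ 0
keeps p outside the square. -/
theorem irreducible_X_pow_sub_C_of_dualNumber [IsDomain K] (hm : m ≠ 0) (ψ : K →+* DualNumber ℂ)
    (h0 : (ψ p).fst = 0) (h1 : ψ p ≠ 0) : Irreducible (X ^ m - C p : K[X]) := by
  let χ : K →+* ℂ := (TrivSqZeroExt.fstHom ℂ ℂ ℂ).toRingHom.comp ψ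
  have hmonic := monic_X_pow_sub_C p hm
  refine irreducible_of_eisenstein_criterion (RingHom.ker_isPrime χ) ?_ ?_ ?_ ?_ hmonic.isPrimitive
  · rw [hmonic.leadingCoeff, RingHom.mem_ker, map_one]
    exact one_ne_zero
  · intro n hn
    rw [degree_X_pow_sub_C (Nat.pos_of_ne_zero hm), Nat.cast_lt] at hn
    rw [coeff_sub, coeff_X_pow, if_neg hn.ne, zero_sub, neg_mem_iff, coeff_C]
    split_ifs
    · exact h0
    · exact zero_mem _
  · rw [degree_X_pow_sub_C (Nat.pos_of_ne_zero hm)]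
    exact_mod_cast Nat.pos_of_ne_zero hm
  · rw [coeff_sub, coeff_X_pow, if_neg hm.symm, zero_sub, neg_mem_iff, coeff_C_zero, pow_two]
    intro hp
    apply h1
    have : ∀ a ∈ RingHom.ker χ * RingHom.ker χ, ψ a = 0 := by
      intro a ha
      induction ha using Submodule.mul_induction_on' with
      | mem_mul_mem x hx y hy =>
        have hx' : (ψ x).fst = 0 := hx
        have hy' : (ψ y).fst = 0 := hy
        rw [map_mul]
        ext <;> simp [hx', hy']
      | add x _ y _ hx hy => rw [map_add, hx, hy, add_zero]
    exact this p hp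

theorem isDomain_adjoinRoot_of_dualNumber [IsDomain K] [IsPrincipalIdealRing K] (hm : m ≠ 0)
    (ψ : K →+* DualNumber ℂ) (h0 : (ψ p).fst = 0) (h1 : ψ p ≠ 0) :
    IsDomain (AdjoinRoot (X ^ m - C p : K[X])) :=
  AdjoinRoot.isDomain_of_prime (irreducible_X_pow_sub_C_of_dualNumber hm ψ h0 h1).prime

theorem AdjoinRoot.root_pow_eq :
    root (X ^ m - C p : K[X]) ^ m = of _ p := by
  have := mk_self (f := (X ^ m - C p : K[X]))
  rw [map_sub, map_pow, mk_X, mk_C] at this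
  exact sub_eq_zero.1 this

/-- Comparison of the coefficients of `1` and `u ^ (m - 1)` in `m * u ^ (m - 1) * b = p' * a`. -/
theorem AdjoinRoot.eval_eq_zero_of_multiple_root [IsDomain K] (hm : 2 ≤ m) {p' x q r : K} {k : ℕ}
    (hp : p = x ^ (k + 2) * q) (hp' : p' = x ^ (k + 1) * r) (hx : x ≠ 0)
    {a b : AdjoinRoot (X ^ m - C p : K[X])}
    (hab : (m : AdjoinRoot (X ^ m - C p : K[X])) * root (X ^ m - C p : K[X]) ^ (m - 1) * b = of _ p' * a)
    (χ : AdjoinRoot (X ^ m - C p : K[X]) →+* ℂ) (hu : χ (root (X ^ m - C p)) = 0)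
    (hχx : χ (of _ x) = 0) (hχr : χ (of _ r) ≠ 0) : χ a = 0 ∧ χ b = 0 := by
  have hm0 : m ≠ 0 := by omega
  have hmonic := monic_X_pow_sub_C p hm0
  have hdeg : (X ^ m - C p : K[X]).degree = m := degree_X_pow_sub_C (Nat.pos_of_ne_zero hm0) p
  have hrep : ∀ c : AdjoinRoot (X ^ m - C p : K[X]), ∃ f : K[X], f.degree < m ∧ mk _ f = c := by
    intro c
    obtain ⟨f, rfl⟩ := mk_surjective c
    refine ⟨f %ₘ (X ^ m - C p), ?_, ?_⟩
    · rw [← hdeg]; exact degree_modByMonic_lt _ hmonic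
    · exact mk_leftInverse hmonic (mk _ f)
  have hχ : ∀ f : K[X], χ (mk _ f) = χ (of _ (f.coeff 0)) := by
    intro f
    conv_lhs => rw [← divX_mul_X_add f]
    rw [map_add, map_mul, mk_X, mk_C, map_add, map_mul, hu, mul_zero, zero_add]
  obtain ⟨F, hF, rfl⟩ := hrep a
  obtain ⟨G, hG, rfl⟩ := hrep b
  have hroot := root_pow_eq (m := m) (p := p)
  have hdivX : G.divX.degree < m := by
    rcases eq_or_ne G 0 with rfl | h
    · simp
    · exact (degree_divX_lt h).trans hG
  have hCmul : ∀ (y : K) (f : K[X]), (C y * f).degree ≤ f.degree := fun y f => by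
    rw [← smul_eq_C_mul]; exact degree_smul_le y f
  -- Writing G = G(0) + X * `G.divX` and replacing u^m by p represents the relation by a polynomial
  -- of degree < m, which must therefore vanish.
  have hzero : (C ((m : K) * G.coeff 0) * X ^ (m - 1) + C (m * p) * G.divX - C p' * F : K[X]) = 0 := by
    refine eq_zero_of_dvd_of_degree_lt (mk_eq_zero.1 ?_) (p := X ^ m - C p) ?_
    · have hG' := congrArg (mk (X ^ m - C p : K[X])) (divX_mul_X_add G)
      rw [map_add, map_mul, mk_X, mk_C] at hG'
      simp only [map_add, map_sub, map_mul, map_pow, mk_X, mk_C, map_natCast]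
      have h1 : root (X ^ m - C p : K[X]) ^ (m - 1) * root _ = of _ p := by
        rw [pow_sub_one_mul hm0, hroot]
      linear_combination hab + m * root (X ^ m - C p : K[X]) ^ (m - 1) * hG' -
        m * mk (X ^ m - C p : K[X]) G.divX * h1
    · rw [hdeg]
      refine lt_of_le_of_lt (degree_sub_le _ _) (max_lt (lt_of_le_of_lt (degree_add_le _ _)
        (max_lt ?_ ?_)) ?_)
      · refine lt_of_le_of_lt (degree_C_mul_X_pow_le _ _) ?_
        exact_mod_cast Nat.sub_lt (Nat.pos_of_ne_zero hm0) one_pos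
      · exact lt_of_le_of_lt (hCmul _ _) hdivX
      · exact lt_of_le_of_lt (hCmul _ _) hF
  have hcoeff : ∀ n, (m : K) * G.coeff 0 * (if n = m - 1 then 1 else 0) +
      m * p * G.divX.coeff n - p' * F.coeff n = 0 := by
    intro n
    have := congrArg (fun f => coeff f n) hzero
    simpa only [coeff_sub, coeff_add, coeff_C_mul, coeff_X_pow, coeff_zero] using this
  have hmC : (m : ℂ) ≠ 0 := Nat.cast_ne_zero.2 hm0
  rw [hχ, hχ]
  constructor
  -- Since m ≥ 2, the u^(m-1) term misses the constant coefficient. Cancelling x^(k+1) leaves a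
  -- factor x on one side and r, nonzero at the point, on the other.
  · have h0 := hcoeff 0
    rw [if_neg (by omega)] at h0
    have h1 : (m : K) * x * q * G.divX.coeff 0 = r * F.coeff 0 := by
      apply mul_left_cancel₀ (pow_ne_zero (k + 1) hx)
      linear_combination h0 - m * G.divX.coeff 0 * hp + F.coeff 0 * hp'
    have h2 := congrArg (fun y => χ (of _ y)) h1
    simp only [map_mul, hχx, mul_zero, zero_mul] at h2
    exact (mul_eq_zero.1 h2.symm).resolve_left hχr
  · have h0 := congrArg (fun y => χ (of _ y)) (hcoeff (m - 1))
    have hχp : χ (of _ p) = 0 := by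
      have := congrArg (fun y => χ (of _ y)) hp
      simpa [hχx] using this
    have hχp' : χ (of _ p') = 0 := by rw [hp']; simp [hχx]
    simp only [if_true, map_sub, map_add, map_mul, hχp, hχp', map_natCast, map_one, map_zero] at h0
    apply mul_left_cancel₀ hmC
    linear_combination h0

theorem AdjoinRoot.subalgebra_eq_top [Algebra ℂ K] {f : K[X]} {S : Subalgebra ℂ (AdjoinRoot f)}
    (hK : ∀ k, of f k ∈ S) (hu : root f ∈ S) : S = ⊤ := by
  rw [eq_top_iff]
  intro a _
  obtain ⟨q, rfl⟩ := mk_surjective a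
  induction q using Polynomial.induction_on' with
  | add q r hq hr => rw [map_add]; exact add_mem (hq trivial) (hr trivial)
  | monomial n k =>
    rw [← C_mul_X_pow_eq_monomial, map_mul, map_pow, mk_X, mk_C]
    exact mul_mem (hK k) (pow_mem hu n)

/-- In a domain of the form `K[u] / (u ^ m - p)`, `t` is integral modulo nonzero ideals. -/
theorem AdjoinRoot.isIntegral_mk_of_isDomain [IsDomain K] [Algebra ℂ K] (hm : m ≠ 0)
    [IsDomain (AdjoinRoot (X ^ m - C p : K[X]))] {τ : K}
    (hK : ∀ k : K, k ≠ 0 → ∃ f : ℂ[X], f ≠ 0 ∧ k ∣ aeval τ f)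
    (I : Ideal (AdjoinRoot (X ^ m - C p : K[X]))) (hI : I ≠ ⊥) :
    IsIntegral ℂ (Ideal.Quotient.mkₐ ℂ I (of _ τ)) := by
  obtain ⟨x, hx, hx0⟩ := Submodule.exists_mem_ne_zero_of_ne_bot hI
  have hfin : Module.Finite K (AdjoinRoot (X ^ m - C p : K[X])) :=
    (monic_X_pow_sub_C p hm).finite_adjoinRoot
  -- In a domain integral over K, every nonzero ideal meets K nontrivially.
  have hcomap := Ideal.comap_ne_bot_of_integral_mem (R := K) hx0 hx (Algebra.IsIntegral.isIntegral x)
  obtain ⟨k, hk, hk0⟩ := Submodule.exists_mem_ne_zero_of_ne_bot hcomap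
  obtain ⟨f, hf0, l, hl⟩ := hK k hk0
  refine IsAlgebraic.isIntegral ⟨f, hf0, ?_⟩
  rw [aeval_algHom_apply, ← coe_ofAlgHom (S := ℂ), aeval_algHom_apply, hl, map_mul, map_mul,
    Ideal.Quotient.mkₐ_eq_mk, Ideal.Quotient.eq_zero_iff_mem.2 (by exact hk), zero_mul]

end Kummer

/-! ### The affine line and the punctured line, treated together. -/

/-- `K` is generated by `τ` (and its inverse, when `inv` holds) subject to no relation. -/
structure IsLine (inv : Prop) {K : Type} [CommRing K] [Algebra ℂ K] (τ : K) : Prop where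
  isUnit : inv → IsUnit τ
  eq_top : ∀ S : Subalgebra ℂ K, τ ∈ S → (∀ y, y * τ = 1 → y ∈ S) → S = ⊤
  finiteType : Algebra.FiniteType ℂ K
  exists_hom : ∀ {B : Type} [CommRing B] [Algebra ℂ B] (b : B), (inv → IsUnit b) →
    ∃ φ : K →ₐ[ℂ] B, φ τ = b
  exists_dvd : ∀ k : K, k ≠ 0 → ∃ f : ℂ[X], f ≠ 0 ∧ k ∣ aeval τ f

theorem isLine_X : IsLine False (X : ℂ[X]) where
  isUnit := False.elim
  eq_top S h _ := by
    rw [eq_top_iff, ← adjoin_X, Algebra.adjoin_le_iff, Set.singleton_subset_iff]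
    exact h
  finiteType := inferInstance
  exists_hom b _ := ⟨aeval b, aeval_X b⟩
  exists_dvd k hk := ⟨k, hk, by rw [aeval_X_left_apply]⟩

theorem isLine_T : IsLine True (LaurentPolynomial.T 1 : ℂ[T;T⁻¹]) where
  isUnit _ := LaurentPolynomial.isUnit_T 1
  eq_top S h h' := LaurentPolynomial.subalgebra_eq_top h
    (h' _ (by rw [← LaurentPolynomial.T_add, neg_add_cancel, LaurentPolynomial.T_zero]))
  finiteType := inferInstance
  exists_hom b hb := LaurentPolynomial.exists_algHom (hb trivial)
  exists_dvd k hk := by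
    obtain ⟨n, f, hf⟩ := LaurentPolynomial.exists_T_pow k
    refine ⟨f, ?_, ?_⟩
    · rw [← toLaurent_ne_zero, hf]
      exact mul_ne_zero hk (LaurentPolynomial.isUnit_T _).ne_zero
    · rw [LaurentPolynomial.aeval_T_one, hf]
      exact dvd_mul_right _ _

theorem isCoprime_of_forall_not_isRoot {F G : ℂ[X]}
    (h : ∀ z, F.IsRoot z → ¬ G.IsRoot z) : IsCoprime F G := by
  rw [Polynomial.isCoprime_iff_aeval_ne_zero_of_isAlgClosed ℂ ℂ]
  intro z
  by_contra! hz
  exact h z (by simpa using hz.1) (by simpa using hz.2)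

namespace IsLine

variable {inv : Prop} {K : Type} [CommRing K] [Algebra ℂ K] {τ : K} {m : ℕ} {P : ℂ[X]} {p : K}

theorem aeval_ne_zero (h : IsLine inv τ) {Q : ℂ[X]} (hQ : Q ≠ 0) : aeval τ Q ≠ 0 := by
  obtain ⟨w, hw⟩ := Infinite.exists_notMem_finset (Q * X).roots.toFinset
  rw [Multiset.mem_toFinset, mem_roots (mul_ne_zero hQ X_ne_zero), IsRoot, eval_mul, eval_X,
    mul_eq_zero, not_or] at hw
  obtain ⟨φ, hφ⟩ := h.exists_hom w fun _ => Ne.isUnit hw.2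
  intro h0
  apply hw.1
  have := congrArg φ h0
  rwa [← aeval_algHom_apply, hφ, map_zero, coe_aeval_eq_eval] at this

theorem aeval_of (F : ℂ[X]) :
    aeval (AdjoinRoot.of (X ^ m - C p : K[X]) τ) F = AdjoinRoot.of _ (aeval τ F) :=
  aeval_algHom_apply (AdjoinRoot.ofAlgHom ℂ (X ^ m - C p : K[X])) τ F

theorem isCurve (h : IsLine inv τ) (hp : aeval τ P = p) :
    IsCurve inv m P (AdjoinRoot.of (X ^ m - C p : K[X]) τ) (AdjoinRoot.root (X ^ m - C p)) where
  rel := by rw [AdjoinRoot.root_pow_eq, aeval_of, hp]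
  isUnit hi := (h.isUnit hi).map _
  eq_top S ht hu hy := by
    refine AdjoinRoot.subalgebra_eq_top (fun k => ?_) hu
    have hS : S.comap (AdjoinRoot.ofAlgHom ℂ (X ^ m - C p : K[X])) = ⊤ :=
      h.eq_top _ ht fun y hyτ => hy _ (by
        change AdjoinRoot.of _ y * _ = 1
        rw [← map_mul, hyτ, map_one])
    have : k ∈ S.comap (AdjoinRoot.ofAlgHom ℂ (X ^ m - C p : K[X])) := by rw [hS]; trivial
    exact this
  finiteType := by
    have := h.finiteType
    infer_instance
  exists_hom b υ hb hυ := by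
    obtain ⟨φ, rfl⟩ := h.exists_hom b hb
    refine ⟨AdjoinRoot.liftAlgHom _ φ υ ?_, AdjoinRoot.liftAlgHom_of _ _ _ _ _,
      AdjoinRoot.liftAlgHom_root _ _ _ _⟩
    rw [eval₂_sub, eval₂_X_pow, eval₂_C, hυ, aeval_algHom_apply, hp, RingHom.coe_coe, sub_self]

theorem not_isSimple_of_multiple_root [IsDomain K] (h : IsLine inv τ) (hm : 2 ≤ m) (hP : P ≠ 0)
    (hp : aeval τ P = p) {z : ℂ} (hz : inv → z ≠ 0) (hroot : 2 ≤ P.rootMultiplicity z) :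
    ¬ LieAlgebra.IsSimple ℂ (Derivation ℂ (AdjoinRoot (X ^ m - C p : K[X]))
      (AdjoinRoot (X ^ m - C p : K[X]))) := by
  obtain ⟨k, Q, R, hQ, hP', -, hRz⟩ :=
    exists_eq_pow_mul_of_two_le_rootMultiplicity hP hroot
  refine (h.isCurve hp).not_isSimple_of_multiple_root hm hP hz hroot fun a b hab χ ht hu => ?_
  rw [aeval_of] at hab
  refine AdjoinRoot.eval_eq_zero_of_multiple_root hm (p' := aeval τ (derivative P))
    (x := aeval τ (X - C z)) (q := aeval τ Q) (r := aeval τ R) (k := k) ?_ ?_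
    (h.aeval_ne_zero (X_sub_C_ne_zero z)) hab χ.toRingHom hu ?_ ?_
  · rw [← hp, ← map_pow, ← map_mul, ← hQ]
  · rw [hP', map_mul, map_pow]
  · rw [← aeval_of]
    change χ _ = 0
    rw [← aeval_algHom_apply, ht]
    simp
  · rw [← aeval_of]
    change χ _ ≠ 0
    rwa [← aeval_algHom_apply, ht, coe_aeval_eq_eval]

theorem isSimple_of_isCoprime [IsDomain K] [IsPrincipalIdealRing K] (h : IsLine inv τ)
    (hm : m ≠ 0) (hp : aeval τ P = p) (hco : IsCoprime (aeval τ P) (aeval τ (derivative P)))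
    {z : ℂ} (hz : inv → z ≠ 0) (hroot : P.IsRoot z) (hroot' : ¬ (derivative P).IsRoot z) :
    LieAlgebra.IsSimple ℂ (Derivation ℂ (AdjoinRoot (X ^ m - C p : K[X]))
      (AdjoinRoot (X ^ m - C p : K[X]))) := by
  obtain ⟨ψ, hψ⟩ := h.exists_hom (B := DualNumber ℂ)
    (algebraMap ℂ _ z + DualNumber.eps) (fun hi => by
      rw [TrivSqZeroExt.isUnit_iff_isUnit_fst]
      simpa [TrivSqZeroExt.algebraMap_eq_inl] using hz hi)
  have hψp : ψ p = algebraMap ℂ _ (P.eval z) +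
      algebraMap ℂ _ ((derivative P).eval z) * DualNumber.eps := by
    rw [← hp, ← aeval_algHom_apply, hψ,
      aeval_add_of_sq_eq_zero _ _ _ (by rw [pow_two, DualNumber.eps_mul_eps]),
      aeval_algebraMap_apply, aeval_algebraMap_apply, coe_aeval_eq_eval]
  rw [hroot, map_zero, zero_add] at hψp
  have hdom : IsDomain (AdjoinRoot (X ^ m - C p : K[X])) := by
    refine isDomain_adjoinRoot_of_dualNumber hm ψ.toRingHom ?_ ?_
    · change (ψ p).fst = 0
      rw [hψp]
      simp
    · change ψ p ≠ 0
      rw [hψp]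
      intro h0
      have := congrArg TrivSqZeroExt.snd h0
      rw [DualNumber.snd_mul] at this
      exact hroot' (by simpa [TrivSqZeroExt.algebraMap_eq_inl] using this)
  obtain ⟨α, β, hαβ⟩ := hco
  have h1 := congrArg (AdjoinRoot.of (X ^ m - C p : K[X])) hαβ
  rw [map_add, map_mul, map_mul, map_one, hp, ← AdjoinRoot.root_pow_eq,
    ← pow_sub_one_mul hm (AdjoinRoot.root _)] at h1
  -- P = u^(m-1) * u, so the cofactor of P absorbs one u.
  refine (h.isCurve hp).isSimple hm (α := AdjoinRoot.of _ α * AdjoinRoot.root _)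
    (β := AdjoinRoot.of _ β) ?_ fun I hI =>
      AdjoinRoot.isIntegral_mk_of_isDomain hm h.exists_dvd I hI
  rw [aeval_of, ← h1]
  ring

end IsLine

/-! ### Monomials c t^r with gcd(r, m) = 1. -/

namespace IsCurve

variable {m : ℕ} {A : Type} [CommRing A] [Algebra ℂ A] {t u : A}

/-- When `gcd r m = 1`, the algebra of the curve `u ^ m = c * t ^ r`, `t ≠ 0` is generated by
a single invertible element `s`, and `t` is integral modulo nonzero ideals. -/
theorem isIntegral_mk_of_monomial {c : ℂ} {r : ℕ} (h : IsCurve True m (C c * X ^ r) t u)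
    (hm : m ≠ 0) (hc : c ≠ 0) (hr : Nat.gcd r m = 1) (I : Ideal A) (hI : I ≠ ⊥) :
    IsIntegral ℂ (Ideal.Quotient.mkₐ ℂ I t) := by
  have hrel : u ^ m = algebraMap ℂ A c * t ^ r := by simpa using h.rel
  obtain ⟨V, rfl⟩ := h.isUnit trivial
  have hcu : IsUnit (algebraMap ℂ A c) := hc.isUnit.map _
  have hu : IsUnit u := by
    rw [← isUnit_pow_iff hm, hrel]
    exact hcu.mul (V.isUnit.pow r)
  obtain ⟨U, rfl⟩ := hu
  set ι : ℂˣ →* Aˣ := Units.map (algebraMap ℂ A) with hι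
  set κ : ℂˣ := Units.mk0 c hc
  have hU : U ^ m = ι κ * V ^ r := by
    ext
    simpa [hι, κ] using hrel
  set a := Nat.gcdA r m
  set b := Nat.gcdB r m
  have hab : (r : ℤ) * a + m * b = 1 := by
    rw [← Nat.gcd_eq_gcd_ab, hr, Nat.cast_one]
  -- The Bézout exponents make t = V and u = U monomials in s up to constants: s^m = c^a V and s^r
  -- c^b = U.
  set s : Aˣ := U ^ a * V ^ b with hs
  have hsm : s ^ m = ι (κ ^ a) * V := by
    calc s ^ m = (U ^ m) ^ a * V ^ (m * b) := by
          rw [hs, mul_pow, ← zpow_natCast, ← zpow_natCast, ← zpow_natCast, ← zpow_mul, ← zpow_mul,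
            ← zpow_mul, mul_comm a, mul_comm b]
      _ = ι (κ ^ a) * V ^ ((r : ℤ) * a + m * b) := by
          rw [hU, mul_zpow, map_zpow, ← zpow_natCast, ← zpow_mul, zpow_add, mul_assoc]
      _ = ι (κ ^ a) * V := by rw [hab, zpow_one]
  have hsr : s ^ r * ι (κ ^ b) = U := by
    calc s ^ r * ι (κ ^ b) = U ^ (r * a) * (ι κ * V ^ r) ^ b := by
          rw [hs, mul_pow, ← zpow_natCast, ← zpow_natCast, ← zpow_natCast, mul_zpow, ← zpow_mul,
            ← zpow_mul, ← zpow_mul, mul_comm a, mul_comm b, map_zpow, mul_assoc,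
            mul_comm (V ^ _)]
      _ = U ^ ((r : ℤ) * a + m * b) := by
          rw [← hU, ← zpow_natCast, ← zpow_mul, zpow_add]
      _ = U := by rw [hab, zpow_one]
  have hV : V = ι (κ ^ (-a)) * s ^ m := by rw [hsm, ← mul_assoc, ← map_mul, ← zpow_add]; simp
  obtain ⟨φ, hφ⟩ := LaurentPolynomial.exists_algHom (B := A) s.isUnit
  have hconst : ∀ x : ℂˣ, ((ι x : Aˣ) : A) ∈ φ.range := fun x => φ.range.algebraMap_mem (x : ℂ)
  have hsmem : (s : A) ∈ φ.range := ⟨_, hφ⟩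
  have hsinv : ((s⁻¹ : Aˣ) : A) ∈ φ.range := by
    refine ⟨LaurentPolynomial.T (-1), ?_⟩
    rw [← Units.mul_eq_one_iff_eq_inv]
    change φ _ * (s : A) = 1
    rw [← hφ, ← map_mul, ← LaurentPolynomial.T_add, neg_add_cancel, LaurentPolynomial.T_zero,
      map_one]
  have htop : φ.range = ⊤ := by
    refine h.eq_top _ ?_ ?_ fun y hy => ?_
    · rw [hV, Units.val_mul, Units.val_pow_eq_pow_val]
      exact mul_mem (hconst _) (pow_mem hsmem m)
    · rw [← hsr, Units.val_mul, Units.val_pow_eq_pow_val]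
      exact mul_mem (pow_mem hsmem r) (hconst _)
    · rw [Units.mul_eq_one_iff_eq_inv.1 hy, hV, mul_inv, ← map_inv, ← inv_pow, Units.val_mul,
        Units.val_pow_eq_pow_val]
      exact mul_mem (hconst _) (pow_mem hsinv m)
  obtain ⟨x, hx, hx0⟩ := Submodule.exists_mem_ne_zero_of_ne_bot hI
  obtain ⟨k, rfl⟩ : x ∈ φ.range := by rw [htop]; trivial
  have hk0 : k ≠ 0 := by rintro rfl; exact hx0 (map_zero φ)
  obtain ⟨f, hf0, l, hl⟩ := isLine_T.exists_dvd k hk0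
  have hsint : IsIntegral ℂ (Ideal.Quotient.mkₐ ℂ I s) := by
    refine IsAlgebraic.isIntegral ⟨f, hf0, ?_⟩
    rw [aeval_algHom_apply, ← hφ, aeval_algHom_apply, hl, map_mul, map_mul,
      Ideal.Quotient.mkₐ_eq_mk, Ideal.Quotient.eq_zero_iff_mem.2 (by exact hx), zero_mul]
  rw [hV, Units.val_mul, Units.val_pow_eq_pow_val, map_mul, map_pow]
  refine IsIntegral.mul ?_ (hsint.pow m)
  change IsIntegral ℂ (Ideal.Quotient.mkₐ ℂ I (algebraMap ℂ A ((κ ^ (-a) : ℂˣ) : ℂ)))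
  rw [AlgHom.commutes]
  exact isIntegral_algebraMap

theorem isSimple_of_monomial {c : ℂ} {r : ℕ} (h : IsCurve True m (C c * X ^ r) t u)
    (hm : m ≠ 0) (hc : c ≠ 0) (hr : Nat.gcd r m = 1) :
    LieAlgebra.IsSimple ℂ (Derivation ℂ A A) := by
  have hrel : u ^ m = algebraMap ℂ A c * t ^ r := by simpa using h.rel
  have hu : IsUnit u := by
    rw [← isUnit_pow_iff hm, hrel]
    exact (hc.isUnit.map _).mul ((h.isUnit trivial).pow r)
  obtain ⟨α, hα⟩ := (hu.pow (m - 1)).exists_left_inv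
  exact h.isSimple hm (α := α) (β := 0) (by rw [hα, zero_mul, add_zero])
    (h.isIntegral_mk_of_monomial hm hc hr)

end IsCurve

/-! ### Assembly of the two equivalences. -/

theorem mainTheorem1 (m : ℕ) (hm : 2 ≤ m) (P : ℂ[X]) (hP : 1 ≤ P.natDegree) :
    (LieAlgebra.IsSimple ℂ (SLie m P) ↔ ∀ z : ℂ, P.rootMultiplicity z ≤ 1) ∧
    (LieAlgebra.IsSimple ℂ (RLie m P) ↔
      (∀ z : ℂ, z ≠ 0 → P.rootMultiplicity z ≤ 1) ∧
      ∀ (c : ℂ) (r : ℕ), c ≠ 0 → Nat.gcd r m ≠ 1 → P ≠ C c * X ^ r) := by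
  have hm0 : m ≠ 0 := by omega
  have hP0 : P ≠ 0 := by rintro rfl; simp at hP
  have hsimple : ∀ z, P.rootMultiplicity z ≤ 1 → P.IsRoot z → ¬ (derivative P).IsRoot z :=
    fun z hz h1 h2 => absurd ((one_lt_rootMultiplicity_iff_isRoot hP0).2 ⟨h1, h2⟩) (by omega)
  constructor
  · have hp : aeval (X : ℂ[X]) P = P := aeval_X_left_apply P
    constructor
    · intro hs z
      by_contra! hz
      exact isLine_X.not_isSimple_of_multiple_root hm hP0 hp False.elim hz hs
    · intro hz
      obtain ⟨z, hroot⟩ := IsAlgClosed.exists_root P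
        (natDegree_pos_iff_degree_pos.1 hP).ne'
      refine isLine_X.isSimple_of_isCoprime hm0 hp ?_ False.elim hroot (hsimple z (hz z) hroot)
      rw [hp, aeval_X_left_apply]
      exact isCoprime_of_forall_not_isRoot fun z => hsimple z (hz z)
  · have hp : aeval (LaurentPolynomial.T 1 : ℂ[T;T⁻¹]) P = toLaurent P :=
      LaurentPolynomial.aeval_T_one P
    constructor
    · intro hs
      refine ⟨fun z hz0 => ?_, ?_⟩
      · by_contra! hz
        exact isLine_T.not_isSimple_of_multiple_root hm hP0 hp (fun _ => hz0) hz hs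
      · rintro c r hc hr rfl
        exact (isLine_T.isCurve hp).not_isSimple_of_monomial hm hc hr hs
    · rintro ⟨hz, hmon⟩
      obtain ⟨Q, hQ, hndvd⟩ := P.exists_eq_pow_rootMultiplicity_mul_and_not_dvd hP0 0
      rw [C_0, sub_zero] at hQ hndvd
      generalize P.rootMultiplicity 0 = s at hQ
      have hQ0 : Q.eval 0 ≠ 0 := fun h0 => hndvd (by
        have := dvd_iff_isRoot.2 h0
        rwa [C_0, sub_zero] at this)
      have hP' : X * derivative P = C (s : ℂ) * P + X ^ s * (X * derivative Q) := by
        rcases Nat.eq_zero_or_pos s with h0 | h0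
        · rw [hQ, h0]; simp
        · rw [hQ, derivative_mul, derivative_X_pow]
          have h2 : (X : ℂ[X]) ^ (s - 1) * X = X ^ s := pow_sub_one_mul h0.ne' X
          rw [← h2]
          ring
      -- With P = X^s Q and Q(0) ≠ 0, either P is a monomial or Q supplies a nonzero root, which is
      -- simple.
      by_cases hdeg : Q.degree = 0
      · rw [eq_C_of_degree_eq_zero hdeg, mul_comm] at hQ
        have hc : Q.coeff 0 ≠ 0 := by rwa [coeff_zero_eq_eval_zero]
        have hr : Nat.gcd s m = 1 := by
          by_contra hr
          exact hmon _ _ hc hr hQ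
        subst hQ
        exact (isLine_T.isCurve hp).isSimple_of_monomial hm0 hc hr
      · obtain ⟨z, hroot⟩ := IsAlgClosed.exists_root Q hdeg
        have hz0 : z ≠ 0 := by rintro rfl; exact hQ0 hroot
        have hProot : ∀ w, Q.IsRoot w → P.IsRoot w := fun w hw => by
          rw [hQ, IsRoot, eval_mul, hw.eq_zero, mul_zero]
        refine isLine_T.isSimple_of_isCoprime hm0 hp ?_ (fun _ => hz0) (hProot z hroot)
          (hsimple z (hz z hz0) (hProot z hroot))
        have hco : IsCoprime Q (X * derivative Q) := by
          refine isCoprime_of_forall_not_isRoot fun w hw hw' => ?_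
          have hw0 : w ≠ 0 := by rintro rfl; exact hQ0 hw
          refine hsimple w (hz w hw0) (hProot w hw) ?_
          have := congrArg (eval w) hP'
          rw [eval_add, eval_mul, eval_mul, eval_mul, (hProot w hw).eq_zero, hw'.eq_zero, eval_X,
            mul_zero, mul_zero, add_zero] at this
          exact (mul_eq_zero.1 this).resolve_left hw0
        obtain ⟨α, β, hαβ⟩ := hco
        obtain ⟨y, hy⟩ := ((LaurentPolynomial.isUnit_T (R := ℂ) 1).pow s).exists_left_inv
        -- X^s lies in the ideal (P, P') of ℂ[X] and becomes a unit in the Laurent polynomials.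
        have key : (α - β * C (s : ℂ)) * P + β * X * derivative P = X ^ s := by
          linear_combination X ^ s * hαβ + β * hP' + α * hQ
        have key' := congrArg (aeval (LaurentPolynomial.T 1 : ℂ[T;T⁻¹])) key
        rw [map_add, map_mul, map_mul _ (β * X), map_pow, aeval_X] at key'
        exact ⟨y * aeval _ (α - β * C (s : ℂ)), y * aeval _ (β * X), by
          linear_combination y * key' + hy⟩
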